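/- Let $N=2^n$ with $n\ge 0$ an integer, and equip $\mathbb{C}^{N\times N}$ and $\mathbb{C}^m$ with the Euclidean norms $\|X\|_2=(\sum_{j,k}|X_{j,k}|^2)^{1/2}$ and $\|y\|_2$. For $X\in\mathbb{C}^{N\times N}$ let $$\|X\|_{TV}=\sum_{j=1}^{N-1}\sum_{k=1}^{N}|X_{j+1,k}-X_{j,k}|+\sum_{j=1}^{N}\sum_{k=1}^{N-1}|X_{j,k+1}-X_{j,k}|.$$ Let $H^0=1_{[0,1)}$, $H^1=1_{[0,1/2)}-1_{[1/2,1)}$, and $H^e_{j,k}(u,v)=2^jH^{e_1}(2^ju-k_1)H^{e_2}(2^jv-k_2)$ for $0\le j\le n-1$, $k\in\{0,\dots,2^j-1\}^2$, $e\in\{(0,1),(1,0),(1,1)\}$. Identify a function $f$ on $[0,1)^2$ that is constant on each cell $[\frac{p-1}{N},\frac pN)\times[\frac{q-1}{N},\frac qN)$, with value $f_{p,q}$ there, with the image $(f_{p,q}/N)_{p,q=1}^N$. The constant function $1$ and the functions $H^e_{j,k}$ then become an orthonormal basis of $\mathbb{C}^{N\times N}$, and the bivariate Haar transform $\mathcal{H}$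 maps $X$ to the vector of its $N^2$ coefficients in this basis. A linear map $\mathcal{A}$ has the restricted isometry property (RIP) of order $r$ and level $\delta$ if $(1-\delta)\|x\|_2^2\le\|\mathcal{A}x\|_2^2\le(1+\delta)\|x\|_2^2$ for all $x$ with at most $r$ nonzero entries. **Theorem (Strong Sobolev inequality).** For every $\delta<1$ there is a constant $C>0$, depending only on $\delta$, such that the following holds for all $N=2^n$, all integers $m\ge0$ and all integers $1\le s\le N^2$. Let $\mathcal{B}:\mathbb{C}^{N\times N}\to\mathbb{C}^m$ be a linear map such that $\mathcal{B}\mathcal{H}^{-1}$ has the RIP of order $2s$ and level $\delta$, and let $D\in\mathbb{C}^{N\times N}$ satisfy $\|\mathcal{B}(D)\|_2\le\varepsilon$. Then $$\|D\|_2\le C\left(\frac{\|D\|_{TV}}{\sqrt s}\,\log\!\left(\frac{N^2}{s}\right)+\varepsilon\right).$$ -/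

import Mathlib

/-- The space `ℂ^{N × N}` of images, with the entrywise `ℓ²` (Frobenius) norm. -/
abbrev Image (N : ℕ) : Type := EuclideanSpace ℂ (Fin N × Fin N)

/-- First component of the discrete gradient: `X_{j+1,k} - X_{j,k}`, and `0` in the last row. -/
def gradX {N : ℕ} (X : Image N) (j k : Fin N) : ℂ :=
  if h : (j : ℕ) + 1 < N then X (⟨(j : ℕ) + 1, h⟩, k) - X (j, k) else 0

/-- Second component of the discrete gradient: `X_{j,k+1} - X_{j,k}`, and `0` in the last column. -/
def gradY {N : ℕ} (X : Image N) (j k : Fin N) : ℂ :=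
  if h : (k : ℕ) + 1 < N then X (j, ⟨(k : ℕ) + 1, h⟩) - X (j, k) else 0

/-- The (anisotropic) total-variation seminorm: the `ℓ¹` norm of the discrete gradient. -/
noncomputable def tvNorm {N : ℕ} (X : Image N) : ℝ :=
  ∑ j : Fin N, ∑ k : Fin N, (‖gradX X j k‖ + ‖gradY X j k‖)

/-- `x` has at most `s` nonzero entries. -/
def IsSparse {ι : Type} (s : ℕ) (x : EuclideanSpace ℂ ι) : Prop :=
  {i | x i ≠ 0}.encard ≤ s

/-- The restricted isometry property of order `s` and level `δ`. -/
def HasRIP {ι κ : Type} [Fintype ι] [Fintype κ]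
    (A : EuclideanSpace ℂ ι →ₗ[ℂ] EuclideanSpace ℂ κ) (s : ℕ) (δ : ℝ) : Prop :=
  ∀ x : EuclideanSpace ℂ ι, IsSparse s x →
    (1 - δ) * ‖x‖ ^ 2 ≤ ‖A x‖ ^ 2 ∧ ‖A x‖ ^ 2 ≤ (1 + δ) * ‖x‖ ^ 2

/-- The univariate Haar functions: `H⁰ = 1_[0,1)` and `H¹ = 1_[0,1/2) - 1_[1/2,1)`. -/
noncomputable def haarUni (e : Fin 2) (t : ℝ) : ℝ :=
  if e = 0 then (if 0 ≤ t ∧ t < 1 then 1 else 0)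
  else (if 0 ≤ t ∧ t < 1 / 2 then 1 else if 1 / 2 ≤ t ∧ t < 1 then -1 else 0)

/-- `H_{j,k}^e(u, v) = 2^j H^{e₁}(2^j u - k₁) H^{e₂}(2^j v - k₂)`. -/
noncomputable def haarBiv (j k₁ k₂ : ℕ) (e : Fin 2 × Fin 2) (u v : ℝ) : ℝ :=
  2 ^ j * (haarUni e.1 (2 ^ j * u - k₁) * haarUni e.2 (2 ^ j * v - k₂))

/-- Indices of the bivariate Haar functions of scale below `n`: one for the constant function, and
triples `(j, k, e)` with `0 ≤ j ≤ n - 1`, `k ∈ {0, …, 2^j - 1}²`, `e ∈ {0, 1}² \ {(0, 0)}`. -/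
abbrev HaarIndex (n : ℕ) : Type :=
  Unit ⊕ (Σ j : Fin n, (Fin (2 ^ (j : ℕ)) × Fin (2 ^ (j : ℕ))) × {e : Fin 2 × Fin 2 // e ≠ (0, 0)})

/-- The bivariate Haar functions on the unit square `[0,1)²`. -/
noncomputable def haarFun {n : ℕ} : HaarIndex n → ℝ → ℝ → ℝ
  | Sum.inl _ => fun _ _ => 1
  | Sum.inr ⟨j, k, e⟩ => haarBiv j k.1 k.2 e.1

/-- The discrete bivariate Haar wavelets for `N = 2^n`. The function is constant on the cell
`[p/N, (p+1)/N) × [q/N, (q+1)/N)` (with `p, q` counted from `0`), and the image is `1/N` times its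
value there. -/
noncomputable def haarVec (n : ℕ) (i : HaarIndex n) : Image (2 ^ n) :=
  WithLp.toLp 2 fun p =>
    (((2 ^ n : ℝ)⁻¹ * haarFun i ((p.1 : ℕ) / 2 ^ n) ((p.2 : ℕ) / 2 ^ n) : ℝ) : ℂ)

/-- Evaluation of the univariate Haar functions on the grid, in terms of natural numbers. -/
theorem haarUni_grid (e : Fin 2) {n j : ℕ} (hj : j < n) (k p : ℕ) :
    haarUni e (2 ^ j * ((p : ℝ) / 2 ^ n) - k) =
      if p / 2 ^ (n - j) = k then
        (if e = 0 then 1 else if p < 2 ^ (n - j - 1) * (2 * k + 1) then 1 else -1)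
      else 0 := by
  obtain ⟨d, rfl⟩ : ∃ d, n = j + (d + 1) := ⟨n - j - 1, by omega⟩
  have e1 : j + (d + 1) - j = d + 1 := by omega
  have e2 : d + 1 - 1 = d := by omega
  rw [e1, e2]
  have hM : (0 : ℝ) < 2 ^ d := by positivity
  have ht : (2 : ℝ) ^ j * ((p : ℝ) / 2 ^ (j + (d + 1))) - k = (p - 2 ^ (d + 1) * k) / 2 ^ (d + 1) := by
    rw [pow_add]; field_simp
  have hM' : (0 : ℝ) < 2 ^ (d + 1) := by positivity
  have hp : ((2 : ℝ) ^ (d + 1)) = 2 * 2 ^ d := by ring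
  have c0 : (0 : ℝ) ≤ (p - 2 ^ (d + 1) * k) / 2 ^ (d + 1) ↔ 2 ^ (d + 1) * k ≤ p := by
    rw [le_div_iff₀ hM', zero_mul, sub_nonneg]; exact_mod_cast Iff.rfl
  have c1 : ((p : ℝ) - 2 ^ (d + 1) * k) / 2 ^ (d + 1) < 1 ↔ p < 2 ^ (d + 1) * (k + 1) := by
    rw [div_lt_iff₀ hM', one_mul, sub_lt_iff_lt_add]
    have : ((2 : ℝ) ^ (d + 1) + 2 ^ (d + 1) * k) = ((2 ^ (d + 1) * (k + 1) : ℕ) : ℝ) := by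
      push_cast; ring
    rw [this]; exact_mod_cast Iff.rfl
  have c2 : ((p : ℝ) - 2 ^ (d + 1) * k) / 2 ^ (d + 1) < 1 / 2 ↔ p < 2 ^ d * (2 * k + 1) := by
    rw [div_lt_iff₀ hM', sub_lt_iff_lt_add]
    have : (1 / 2 * (2 : ℝ) ^ (d + 1) + 2 ^ (d + 1) * k) = ((2 ^ d * (2 * k + 1) : ℕ) : ℝ) := by
      push_cast; ring
    rw [this]; exact_mod_cast Iff.rfl
  have cb : p / 2 ^ (d + 1) = k ↔ (2 ^ (d + 1) * k ≤ p ∧ p < 2 ^ (d + 1) * (k + 1)) := by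
    rw [Nat.div_eq_iff (by positivity)]
    have := Nat.one_le_two_pow (n := d + 1)
    rw [mul_add, mul_one, mul_comm k]
    omega
  have hN : (2 : ℕ) ^ (d + 1) = 2 * 2 ^ d := by ring
  have x1 : 2 ^ d * (2 * k + 1) = 2 ^ (d + 1) * k + 2 ^ d := by rw [hN]; ring
  have x2 : 2 ^ (d + 1) * (k + 1) = 2 ^ (d + 1) * k + 2 ^ d + 2 ^ d := by rw [hN]; ring
  unfold haarUni
  rw [ht]
  have c3 : (1 : ℝ) / 2 ≤ (p - 2 ^ (d + 1) * k) / 2 ^ (d + 1) ↔ ¬ p < 2 ^ d * (2 * k + 1) := by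
    rw [← c2, not_lt]
  simp only [c0, c1, c2, c3, cb]
  rw [x1, x2]
  split_ifs <;> first | rfl | (exfalso; omega)

/-- A Haar wavelet has mean zero against anything constant on its support. -/
theorem haarUni_sum_zero {n j : ℕ} (hj : j < n) (k : ℕ) (hk : k < 2 ^ j) (c : ℝ) (f : ℕ → ℝ)
    (hf : ∀ p, p / 2 ^ (n - j) = k → f p = c) :
    ∑ p : Fin (2 ^ n), f p * haarUni 1 (2 ^ j * (((p : ℕ) : ℝ) / 2 ^ n) - k) = 0 := by
  rw [Fin.sum_univ_eq_sum_range (fun p => f p * haarUni 1 (2 ^ j * ((p : ℝ) / 2 ^ n) - k))]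
  simp only [haarUni_grid 1 hj]
  obtain ⟨d, rfl⟩ : ∃ d, n = j + (d + 1) := ⟨n - j - 1, by omega⟩
  have e1 : j + (d + 1) - j = d + 1 := by omega
  have e2 : d + 1 - 1 = d := by omega
  rw [e1] at hf
  rw [e1, e2]
  have hN : (2 : ℕ) ^ (d + 1) = 2 * 2 ^ d := by ring
  have x1 : 2 ^ d * (2 * k + 1) = 2 ^ (d + 1) * k + 2 ^ d := by rw [hN]; ring
  have x2 : 2 ^ (d + 1) * (k + 1) = 2 ^ (d + 1) * k + 2 ^ d + 2 ^ d := by rw [hN]; ring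
  have cb : ∀ p, p / 2 ^ (d + 1) = k ↔ (2 ^ (d + 1) * k ≤ p ∧ p < 2 ^ (d + 1) * (k + 1)) := by
    intro p
    rw [Nat.div_eq_iff (by positivity)]
    have := Nat.one_le_two_pow (n := d + 1)
    rw [mul_add, mul_one, mul_comm k]
    omega
  have hle : 2 ^ (d + 1) * (k + 1) ≤ 2 ^ (j + (d + 1)) := by
    rw [pow_add 2 j (d + 1), mul_comm]; exact Nat.mul_le_mul_right _ hk
  set a := 2 ^ (d + 1) * k with ha
  set M := 2 ^ d with hMdef
  have step : ∀ p ∈ Finset.range (2 ^ (j + (d + 1))),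
      (f p * if p / 2 ^ (d + 1) = k then
        (if (1 : Fin 2) = 0 then (1 : ℝ) else if p < M * (2 * k + 1) then 1 else -1) else 0) =
      (if p ∈ Finset.Ico a (a + M) then c else 0) -
        (if p ∈ Finset.Ico (a + M) (a + M + M) then c else 0) := by
    intro p _
    by_cases h : p / 2 ^ (d + 1) = k
    · have h' := (cb p).1 h
      rw [x2] at h'
      rw [hf p h, x1]
      simp only [Finset.mem_Ico, h, if_true]
      by_cases h2 : p < a + M
      · rw [if_neg (by decide), if_pos h2, if_pos (by omega), if_neg (by omega)]; ring
      · rw [if_neg (by decide), if_neg h2, if_neg (by omega), if_pos (by omega)]; ring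
    · have h' := (not_congr (cb p)).1 h
      rw [x2] at h'
      simp only [Finset.mem_Ico, h, if_false]
      rw [if_neg (by omega), if_neg (by omega)]; ring
  rw [Finset.sum_congr rfl step, Finset.sum_sub_distrib, Finset.sum_ite_mem, Finset.sum_ite_mem,
    Finset.inter_eq_right.2, Finset.inter_eq_right.2]
  · simp
  · intro p; simp only [Finset.mem_Ico, Finset.mem_range]; omega
  · intro p; simp only [Finset.mem_Ico, Finset.mem_range]; omega

theorem haarUni_sum_sq (e : Fin 2) {n j : ℕ} (hj : j < n) (k : ℕ) (hk : k < 2 ^ j) :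
    ∑ p : Fin (2 ^ n), haarUni e (2 ^ j * (((p : ℕ) : ℝ) / 2 ^ n) - k) *
      haarUni e (2 ^ j * (((p : ℕ) : ℝ) / 2 ^ n) - k) = 2 ^ (n - j) := by
  rw [Fin.sum_univ_eq_sum_range (fun p => haarUni e (2 ^ j * ((p : ℝ) / 2 ^ n) - k) *
    haarUni e (2 ^ j * ((p : ℝ) / 2 ^ n) - k))]
  simp only [haarUni_grid e hj]
  have cb : ∀ p, p / 2 ^ (n - j) = k ↔ (2 ^ (n - j) * k ≤ p ∧ p < 2 ^ (n - j) * k + 2 ^ (n - j)) := by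
    intro p
    rw [Nat.div_eq_iff (by positivity)]
    have := Nat.one_le_two_pow (n := n - j)
    rw [mul_comm k]
    omega
  have hle : 2 ^ (n - j) * k + 2 ^ (n - j) ≤ 2 ^ n := by
    calc 2 ^ (n - j) * k + 2 ^ (n - j) = 2 ^ (n - j) * (k + 1) := by ring
      _ ≤ 2 ^ (n - j) * 2 ^ j := Nat.mul_le_mul_left _ hk
      _ = 2 ^ n := by rw [← pow_add]; congr 1; omega
  have step : ∀ p ∈ Finset.range (2 ^ n),
      ((if p / 2 ^ (n - j) = k then
        (if e = 0 then (1 : ℝ) else if p < 2 ^ (n - j - 1) * (2 * k + 1) then 1 else -1) else 0) *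
      (if p / 2 ^ (n - j) = k then
        (if e = 0 then (1 : ℝ) else if p < 2 ^ (n - j - 1) * (2 * k + 1) then 1 else -1) else 0)) =
      if p ∈ Finset.Ico (2 ^ (n - j) * k) (2 ^ (n - j) * k + 2 ^ (n - j)) then 1 else 0 := by
    intro p _
    simp only [Finset.mem_Ico, ← cb]
    split_ifs <;> norm_num
  rw [Finset.sum_congr rfl step, Finset.sum_ite_mem, Finset.inter_eq_right.2]
  · simp
  · intro p; simp only [Finset.mem_Ico, Finset.mem_range]; omega

theorem haarUni_sum_disjoint (e e' : Fin 2) {n j : ℕ} (hj : j < n) {k k' : ℕ} (hk : k ≠ k') :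
    ∑ p : Fin (2 ^ n), haarUni e (2 ^ j * (((p : ℕ) : ℝ) / 2 ^ n) - k) *
      haarUni e' (2 ^ j * (((p : ℕ) : ℝ) / 2 ^ n) - k') = 0 := by
  refine Finset.sum_eq_zero fun p _ => ?_
  rw [haarUni_grid e hj, haarUni_grid e' hj]
  split_ifs with h1 h2 <;> first | omega | simp

/-- A Haar function of a coarser scale is constant on the dyadic intervals of a finer scale. -/
theorem haarUni_coarse (e : Fin 2) {n j j' : ℕ} (hjj : j < j') (hj' : j' < n) (k k' p p' : ℕ)
    (hp : p / 2 ^ (n - j') = k') (hp' : p' / 2 ^ (n - j') = k') :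
    haarUni e (2 ^ j * ((p : ℝ) / 2 ^ n) - k) = haarUni e (2 ^ j * ((p' : ℝ) / 2 ^ n) - k) := by
  rw [haarUni_grid e (hjj.trans hj'), haarUni_grid e (hjj.trans hj')]
  have hd : ∀ (a b q : ℕ), a ≤ b → q / 2 ^ b = q / 2 ^ a / 2 ^ (b - a) := by
    intro a b q hab
    rw [Nat.div_div_eq_div_mul, ← pow_add]; congr 2; omega
  have h1 : p / 2 ^ (n - j) = p' / 2 ^ (n - j) := by
    rw [hd (n - j') (n - j) p (by omega), hd (n - j') (n - j) p' (by omega), hp, hp']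
  have h2 : p / 2 ^ (n - j - 1) = p' / 2 ^ (n - j - 1) := by
    rw [hd (n - j') (n - j - 1) p (by omega), hd (n - j') (n - j - 1) p' (by omega), hp, hp']
  have h3 : (p < 2 ^ (n - j - 1) * (2 * k + 1)) ↔ (p' < 2 ^ (n - j - 1) * (2 * k + 1)) := by
    rw [mul_comm, ← Nat.div_lt_iff_lt_mul (by positivity), ← Nat.div_lt_iff_lt_mul (by positivity),
      h2]
  rw [h1]
  simp only [h3]

/-- Inner products of discrete wavelets factor through the two coordinates. -/
theorem haarBiv_sum (n j j' k₁ k₂ l₁ l₂ : ℕ) (e e' : Fin 2 × Fin 2) :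
    ∑ p : Fin (2 ^ n) × Fin (2 ^ n),
      haarBiv j k₁ k₂ e ((p.1 : ℕ) / 2 ^ n) ((p.2 : ℕ) / 2 ^ n) *
        haarBiv j' l₁ l₂ e' ((p.1 : ℕ) / 2 ^ n) ((p.2 : ℕ) / 2 ^ n) =
    2 ^ j * 2 ^ j' *
      ((∑ p : Fin (2 ^ n), haarUni e.1 (2 ^ j * (((p : ℕ) : ℝ) / 2 ^ n) - k₁) *
          haarUni e'.1 (2 ^ j' * (((p : ℕ) : ℝ) / 2 ^ n) - l₁)) *
        ∑ p : Fin (2 ^ n), haarUni e.2 (2 ^ j * (((p : ℕ) : ℝ) / 2 ^ n) - k₂) *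
          haarUni e'.2 (2 ^ j' * (((p : ℕ) : ℝ) / 2 ^ n) - l₂)) := by
  rw [Finset.sum_mul_sum, Fintype.sum_prod_type, Finset.mul_sum]
  refine Finset.sum_congr rfl fun p _ => ?_
  rw [Finset.mul_sum]
  refine Finset.sum_congr rfl fun q _ => ?_
  unfold haarBiv
  ring

theorem haarBiv_coarse_sum {n j j' : ℕ} (hjj : j < j') (hj' : j' < n) (k₁ k₂ l₁ l₂ : ℕ)
    (hl₁ : l₁ < 2 ^ j') (hl₂ : l₂ < 2 ^ j') (e e' : Fin 2 × Fin 2) (he' : e' ≠ (0, 0)) :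
    ∑ p : Fin (2 ^ n) × Fin (2 ^ n),
      haarBiv j k₁ k₂ e ((p.1 : ℕ) / 2 ^ n) ((p.2 : ℕ) / 2 ^ n) *
        haarBiv j' l₁ l₂ e' ((p.1 : ℕ) / 2 ^ n) ((p.2 : ℕ) / 2 ^ n) = 0 := by
  have key : ∀ (a : Fin 2) (k l : ℕ), l < 2 ^ j' →
      ∑ p : Fin (2 ^ n), haarUni a (2 ^ j * (((p : ℕ) : ℝ) / 2 ^ n) - k) *
        haarUni 1 (2 ^ j' * (((p : ℕ) : ℝ) / 2 ^ n) - l) = 0 := by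
    intro a k l hl
    refine haarUni_sum_zero hj' l hl
      (haarUni a (2 ^ j * (((l * 2 ^ (n - j') : ℕ) : ℝ) / 2 ^ n) - k))
      (fun p => haarUni a (2 ^ j * ((p : ℝ) / 2 ^ n) - k)) fun p hp => ?_
    exact haarUni_coarse a hjj hj' k l _ _ hp (Nat.mul_div_cancel _ (by positivity))
  rw [haarBiv_sum]
  obtain ⟨a, b⟩ := e'
  have : a = 1 ∨ b = 1 := by
    revert he'; revert a b; decide
  rcases this with rfl | rfl
  · rw [key _ _ _ hl₁]; ring
  · rw [key _ _ _ hl₂]; ring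

theorem haarBiv_const_sum {n j : ℕ} (hj : j < n) (l₁ l₂ : ℕ)
    (hl₁ : l₁ < 2 ^ j) (hl₂ : l₂ < 2 ^ j) (e : Fin 2 × Fin 2) (he : e ≠ (0, 0)) :
    ∑ p : Fin (2 ^ n) × Fin (2 ^ n),
      haarBiv j l₁ l₂ e ((p.1 : ℕ) / 2 ^ n) ((p.2 : ℕ) / 2 ^ n) = 0 := by
  have key : ∀ l : ℕ, l < 2 ^ j →
      ∑ p : Fin (2 ^ n), haarUni 1 (2 ^ j * (((p : ℕ) : ℝ) / 2 ^ n) - l) = 0 := by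
    intro l hl
    simpa using haarUni_sum_zero hj l hl 1 (fun _ => 1) fun _ _ => rfl
  have fac : ∑ p : Fin (2 ^ n) × Fin (2 ^ n),
      haarBiv j l₁ l₂ e ((p.1 : ℕ) / 2 ^ n) ((p.2 : ℕ) / 2 ^ n) = 2 ^ j *
      ((∑ p : Fin (2 ^ n), haarUni e.1 (2 ^ j * (((p : ℕ) : ℝ) / 2 ^ n) - l₁)) *
        ∑ p : Fin (2 ^ n), haarUni e.2 (2 ^ j * (((p : ℕ) : ℝ) / 2 ^ n) - l₂)) := by
    rw [Finset.sum_mul_sum, Fintype.sum_prod_type, Finset.mul_sum]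
    refine Finset.sum_congr rfl fun p _ => ?_
    rw [Finset.mul_sum]
    rfl
  rw [fac]
  clear fac
  obtain ⟨a, b⟩ := e
  have : a = 1 ∨ b = 1 := by
    revert he; revert a b; decide
  rcases this with rfl | rfl
  · rw [key _ hl₁]; ring
  · rw [key _ hl₂]; ring

theorem haarBiv_same_sum {n j : ℕ} (hj : j < n) (k₁ k₂ l₁ l₂ : ℕ)
    (hk₁ : k₁ < 2 ^ j) (hk₂ : k₂ < 2 ^ j) (e e' : Fin 2 × Fin 2) :
    ∑ p : Fin (2 ^ n) × Fin (2 ^ n),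
      haarBiv j k₁ k₂ e ((p.1 : ℕ) / 2 ^ n) ((p.2 : ℕ) / 2 ^ n) *
        haarBiv j l₁ l₂ e' ((p.1 : ℕ) / 2 ^ n) ((p.2 : ℕ) / 2 ^ n) =
      if k₁ = l₁ ∧ k₂ = l₂ ∧ e = e' then (2 ^ n) ^ 2 else 0 := by
  have key : ∀ (a b : Fin 2) (k : ℕ), k < 2 ^ j → a ≠ b →
      ∑ p : Fin (2 ^ n), haarUni a (2 ^ j * (((p : ℕ) : ℝ) / 2 ^ n) - k) *
        haarUni b (2 ^ j * (((p : ℕ) : ℝ) / 2 ^ n) - k) = 0 := by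
    have main : ∀ k : ℕ, k < 2 ^ j →
        ∑ p : Fin (2 ^ n), haarUni 0 (2 ^ j * (((p : ℕ) : ℝ) / 2 ^ n) - k) *
          haarUni 1 (2 ^ j * (((p : ℕ) : ℝ) / 2 ^ n) - k) = 0 := by
      intro k hk
      refine haarUni_sum_zero hj k hk 1
        (fun p => haarUni 0 (2 ^ j * ((p : ℝ) / 2 ^ n) - k)) fun p hp => ?_
      rw [haarUni_grid 0 hj, if_pos hp, if_pos rfl]
    intro a b k hk hab
    have : (a = 0 ∧ b = 1) ∨ (a = 1 ∧ b = 0) := by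
      revert hab; revert a b; decide
    rcases this with ⟨rfl, rfl⟩ | ⟨rfl, rfl⟩
    · exact main k hk
    · simpa only [mul_comm] using main k hk
  rw [haarBiv_sum]
  obtain ⟨a, b⟩ := e
  obtain ⟨a', b'⟩ := e'
  simp only [Prod.mk.injEq]
  by_cases h1 : k₁ = l₁
  · subst h1
    by_cases h2 : k₂ = l₂
    · subst h2
      by_cases h3 : a = a'
      · subst h3
        by_cases h4 : b = b'
        · subst h4
          rw [haarUni_sum_sq a hj k₁ hk₁, haarUni_sum_sq b hj k₂ hk₂, if_pos (by simp)]
          have : (2 : ℝ) ^ n = 2 ^ j * 2 ^ (n - j) := by rw [← pow_add]; congr 1; omega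
          rw [this]; ring
        · rw [key b b' k₂ hk₂ h4, if_neg (by tauto)]; ring
      · rw [key a a' k₁ hk₁ h3, if_neg (by tauto)]; ring
    · rw [haarUni_sum_disjoint b b' hj h2, if_neg (by tauto)]; ring
  · rw [haarUni_sum_disjoint a a' hj h1, if_neg (by tauto)]; ring

theorem haarVec_inner (n : ℕ) (i i' : HaarIndex n) :
    inner ℂ (haarVec n i) (haarVec n i') =
      (((2 ^ n : ℝ)⁻¹ ^ 2 * ∑ p : Fin (2 ^ n) × Fin (2 ^ n),
        haarFun i ((p.1 : ℕ) / 2 ^ n) ((p.2 : ℕ) / 2 ^ n) *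
          haarFun i' ((p.1 : ℕ) / 2 ^ n) ((p.2 : ℕ) / 2 ^ n) : ℝ) : ℂ) := by
  rw [PiLp.inner_apply, Finset.mul_sum, Complex.ofReal_sum]
  refine Finset.sum_congr rfl fun p _ => ?_
  simp only [haarVec, RCLike.inner_apply, Complex.conj_ofReal]
  rw [← Complex.ofReal_mul]
  congr 1
  ring

theorem haarVec_orthonormal (n : ℕ) : Orthonormal ℂ (haarVec n) := by
  have hN : (2 ^ n : ℝ) ≠ 0 := by positivity
  rw [orthonormal_iff_ite]
  intro i i'
  rw [haarVec_inner]
  rcases i with u | ⟨j, k, e⟩ <;> rcases i' with u' | ⟨j', k', e'⟩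
  · rw [if_pos (by cases u; cases u'; rfl)]
    simp only [haarFun, mul_one, Finset.sum_const, Finset.card_univ, Fintype.card_prod,
      Fintype.card_fin, nsmul_eq_mul]
    push_cast
    field_simp
  · rw [if_neg (by simp)]
    simp only [haarFun, one_mul]
    rw [haarBiv_const_sum j'.2 _ _ k'.1.2 k'.2.2 _ e'.2]
    simp
  · rw [if_neg (by simp)]
    simp only [haarFun, mul_one]
    rw [haarBiv_const_sum j.2 _ _ k.1.2 k.2.2 _ e.2]
    simp
  · simp only [haarFun]
    rcases lt_trichotomy j j' with h | h | h
    · rw [haarBiv_coarse_sum h j'.2 _ _ _ _ k'.1.2 k'.2.2 _ _ e'.2, if_neg]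
      · simp
      · intro hh
        exact h.ne (congrArg Sigma.fst (Sum.inr_injective hh))
    · subst h
      rw [haarBiv_same_sum j.2 _ _ _ _ k.1.2 k.2.2]
      by_cases hc : (k, e) = (k', e')
      · obtain ⟨rfl, rfl⟩ := Prod.mk.inj hc
        rw [if_pos (by simp), if_pos rfl]
        push_cast
        field_simp
      · rw [if_neg, if_neg]
        · simp
        · intro hh
          exact hc (eq_of_heq (Sigma.mk.inj (Sum.inr_injective hh)).2)
        · rintro ⟨h1, h2, h3⟩
          exact hc (Prod.ext (Prod.ext (Fin.ext h1) (Fin.ext h2)) (Subtype.ext h3))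
    · simp only [mul_comm (haarBiv (j : ℕ) _ _ _ _ _)]
      rw [haarBiv_coarse_sum h j.2 _ _ _ _ k.1.2 k.2.2 _ _ e.2, if_neg]
      · simp
      · intro hh
        exact h.ne (congrArg Sigma.fst (Sum.inr_injective hh)).symm

theorem card_haarIndex (n : ℕ) : Fintype.card (HaarIndex n) = 2 ^ n * 2 ^ n := by
  have h3 : Fintype.card {e : Fin 2 × Fin 2 // e ≠ (0, 0)} = 3 := by decide
  simp only [Fintype.card_sum, Fintype.card_unit, Fintype.card_sigma, Fintype.card_prod,
    Fintype.card_fin, h3]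
  rw [Fin.sum_univ_eq_sum_range (fun j => 2 ^ j * 2 ^ j * 3)]
  induction n with
  | zero => simp
  | succ n ih =>
    rw [Finset.sum_range_succ, ← add_assoc, ih]
    ring

/-- The discrete bivariate Haar wavelets as an orthonormal basis of `ℂ^{N × N}`, `N = 2^n`. -/
noncomputable def haarBasis (n : ℕ) : OrthonormalBasis (HaarIndex n) ℂ (Image (2 ^ n)) :=
  OrthonormalBasis.mk (haarVec_orthonormal n) (by
    rw [(haarVec_orthonormal n).linearIndependent.span_eq_top_of_card_eq_finrank' (by
      rw [card_haarIndex, finrank_euclideanSpace, Fintype.card_prod, Fintype.card_fin])])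

/-- The bivariate Haar transform `X ↦ (⟨X, h_{j,k}^e⟩)`, as a linear isomorphism. -/
noncomputable def haarTransform (n : ℕ) :
    Image (2 ^ n) ≃ₗ[ℂ] EuclideanSpace ℂ (HaarIndex n) :=
  (haarBasis n).repr.toLinearEquiv

/-- The entries of the Haar transform are the coefficients `⟨X, h⟩ = trace (X h*)`. -/
theorem haarTransform_apply (n : ℕ) (X : Image (2 ^ n)) (i : HaarIndex n) :
    haarTransform n X i = ∑ p, X p * (starRingEnd ℂ) (haarVec n i p) := by
  have h : haarBasis n i = haarVec n i := by simp [haarBasis]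
  change (haarBasis n).repr X i = _
  rw [OrthonormalBasis.repr_apply_apply, h, PiLp.inner_apply]
  rfl

/-! The Haar transform is an isometry, so it suffices to bound the coefficient vector `x` of `D`.
Two estimates combine.

Compressed sensing (`HasRIP.norm_le`): for every set `S` of at most `s` indices, the norm of `x` is
at most a constant times `‖A x‖` plus the `ℓ¹` norm of `x` off `S` divided by `√s`. Cut the
complement of `S` into blocks of `s` indices by decreasing modulus. The first block joins `S` and is
handled by the lower RIP bound; the norm of each later block is at most the `ℓ¹` norm of the
preceding block over `√s` (`exists_tail_seminorm_le`).

Haar side (`sum_norm_haarTransform_le`): for each scale and each of the three types `e`, the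
coefficients have `ℓ¹` norm at most the total variation. A wavelet of mean zero sees only the
variation over its support, and the supports at one scale are disjoint.

Take for `S` the constant and all scales below `J`, where `4 ^ J ≤ s < 4 ^ (J + 1)`; these are `4 ^
J` indices. The `n - J` remaining scales contribute `3 (n - J)` total variations, and their number
is the source of the logarithm. When `2 s ≥ N²` the logarithm may vanish, but then every vector is
`2s`-sparse and the lower RIP bound suffices. -/

/-! ### Sparse blocks and the restricted isometry property -/

/-- The restriction of a vector to a set of coordinates, extended by zero. -/
noncomputable def restrictTo {ι : Type} [DecidableEq ι] (T : Finset ι) (x : EuclideanSpace ℂ ι) :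
    EuclideanSpace ℂ ι :=
  WithLp.toLp 2 fun i => if i ∈ T then x i else 0

theorem restrictTo_apply {ι : Type} [DecidableEq ι] (T : Finset ι) (x : EuclideanSpace ℂ ι)
    (i : ι) : restrictTo T x i = if i ∈ T then x i else 0 := rfl

theorem restrictTo_add_of_disjoint {ι : Type} [DecidableEq ι] {S T : Finset ι} (h : Disjoint S T)
    (x : EuclideanSpace ℂ ι) : restrictTo S x + restrictTo T x = restrictTo (S ∪ T) x := by
  ext i
  have hST : i ∈ S → i ∉ T := fun hi => Finset.disjoint_left.1 h hi
  simp only [PiLp.add_apply, restrictTo_apply, Finset.mem_union]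
  by_cases h1 : i ∈ S <;> by_cases h2 : i ∈ T <;> simp_all

theorem restrictTo_univ {ι : Type} [DecidableEq ι] [Fintype ι] (x : EuclideanSpace ℂ ι) :
    restrictTo Finset.univ x = x := by
  ext i; simp [restrictTo_apply]

theorem restrictTo_empty {ι : Type} [DecidableEq ι] (x : EuclideanSpace ℂ ι) :
    restrictTo ∅ x = 0 := by
  ext i; simp [restrictTo_apply]

theorem isSparse_restrictTo {ι : Type} [DecidableEq ι] (T : Finset ι) (x : EuclideanSpace ℂ ι)
    {s : ℕ} (hs : T.card ≤ s) : IsSparse s (restrictTo T x) := by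
  have hsub : {i | restrictTo T x i ≠ 0} ⊆ (T : Set ι) := by
    intro i hi
    by_contra h
    exact hi (by rw [restrictTo_apply, if_neg (by simpa using h)])
  refine (Set.encard_le_encard hsub).trans ?_
  rw [Set.encard_coe_eq_coe_finsetCard]
  exact_mod_cast hs

theorem norm_restrictTo_le {ι : Type} [DecidableEq ι] [Fintype ι] (T : Finset ι)
    (x : EuclideanSpace ℂ ι) {a : ℝ} {s : ℕ} (hs : T.card ≤ s) (ha0 : 0 ≤ a)
    (ha : ∀ i ∈ T, ‖x i‖ ≤ a) : ‖restrictTo T x‖ ≤ √(s : ℝ) * a := by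
  have h1 : ‖restrictTo T x‖ ^ 2 ≤ s * a ^ 2 := by
    rw [EuclideanSpace.norm_sq_eq]
    calc ∑ i, ‖restrictTo T x i‖ ^ 2 = ∑ i, if i ∈ T then ‖x i‖ ^ 2 else 0 := by
          refine Finset.sum_congr rfl fun i _ => ?_
          rw [restrictTo_apply]; split_ifs <;> simp
      _ = ∑ i ∈ T, ‖x i‖ ^ 2 := by simp
      _ ≤ T.card • a ^ 2 := Finset.sum_le_card_nsmul _ _ _ fun i hi =>
          pow_le_pow_left₀ (norm_nonneg _) (ha i hi) 2
      _ ≤ s * a ^ 2 := by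
          rw [nsmul_eq_mul]
          have : (T.card : ℝ) ≤ s := by exact_mod_cast hs
          gcongr
  refine le_of_pow_le_pow_left₀ two_ne_zero (by positivity) ?_
  rwa [mul_pow, Real.sq_sqrt (by positivity)]

/-- A finite set with at least `s` elements contains `s` elements carrying the largest values. -/
theorem exists_subset_card_eq_of_largest {ι : Type} [DecidableEq ι] (f : ι → ℝ) (T : Finset ι)
    {s : ℕ} (hs : s ≤ T.card) :
    ∃ U ⊆ T, U.card = s ∧ ∀ i ∈ U, ∀ j ∈ T \ U, f j ≤ f i := by
  induction s with
  | zero => exact ⟨∅, by simp, rfl, by simp⟩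
  | succ s ih =>
    obtain ⟨U, hUT, hU, hmax⟩ := ih (by omega)
    have hne : (T \ U).Nonempty := by
      rw [← Finset.card_pos, Finset.card_sdiff_of_subset hUT]; omega
    obtain ⟨a, ha, hamax⟩ := Finset.exists_max_image (T \ U) f hne
    have ha' := Finset.mem_sdiff.1 ha
    refine ⟨insert a U, Finset.insert_subset ha'.1 hUT, by
      rw [Finset.card_insert_of_notMem ha'.2, hU], fun i hi j hj => ?_⟩
    have hj' : j ∈ T \ U := by
      simp only [Finset.mem_sdiff, Finset.mem_insert, not_or] at hj ⊢
      exact ⟨hj.1, hj.2.2⟩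
    rcases Finset.mem_insert.1 hi with rfl | hi
    · exact hamax j hj'
    · exact hmax i hi j hj'

/-- Outside a suitable set of `s` coordinates, a seminorm that is controlled by the Euclidean norm
on `s`-sparse vectors is controlled by the `ℓ¹` norm divided by `√s`. -/
theorem exists_tail_seminorm_le {ι : Type} [DecidableEq ι] [Fintype ι]
    (Φ : Seminorm ℂ (EuclideanSpace ℂ ι)) {K : ℝ} (hK : 0 ≤ K) {s : ℕ} (hs : 1 ≤ s)
    (hΦ : ∀ y, IsSparse s y → Φ y ≤ K * ‖y‖) (x : EuclideanSpace ℂ ι) (T : Finset ι) :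
    ∃ U ⊆ T, U.card ≤ s ∧ Φ (restrictTo (T \ U) x) ≤ K * ((∑ i ∈ T, ‖x i‖) / √(s : ℝ)) ∧
      ∀ a, (∀ i ∈ T, ‖x i‖ ≤ a) → 0 ≤ a → ‖restrictTo U x‖ ≤ √(s : ℝ) * a := by
  -- The last conclusion serves the induction: it bounds the next block `U` from a bound on all
  -- entries, without identifying `U`.
  induction T using Finset.strongInduction with
  | H T ih =>
    by_cases hT : T.card ≤ s
    · refine ⟨T, subset_rfl, hT, ?_, fun a ha ha0 => norm_restrictTo_le T x hT ha0 ha⟩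
      rw [Finset.sdiff_self, restrictTo_empty, map_zero]
      positivity
    · obtain ⟨V, hVT, hV, hmax⟩ :=
        exists_subset_card_eq_of_largest (fun i => ‖x i‖) T (not_le.1 hT).le
      have hVne : V.Nonempty := by rw [← Finset.card_pos]; omega
      obtain ⟨U, hUT, hU, hΦU, hUa⟩ := ih (T \ V) (Finset.sdiff_ssubset hVT hVne)
      refine ⟨V, hVT, hV.le, ?_, fun a ha ha0 =>
        norm_restrictTo_le V x hV.le ha0 fun i hi => ha i (hVT hi)⟩
      have hs0 : (0 : ℝ) < s := by exact_mod_cast hs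
      have hsplit : restrictTo (T \ V) x = restrictTo U x + restrictTo ((T \ V) \ U) x := by
        rw [restrictTo_add_of_disjoint Finset.disjoint_sdiff, Finset.union_sdiff_of_subset hUT]
      -- Every entry outside `V` is at most the average over the `s` entries of `V`.
      have hU1 : ‖restrictTo U x‖ ≤ (∑ i ∈ V, ‖x i‖) / √(s : ℝ) := by
        have := hUa ((∑ i ∈ V, ‖x i‖) / s) (fun j hj => by
          rw [le_div_iff₀ hs0, mul_comm, ← nsmul_eq_mul, ← hV]
          exact Finset.card_nsmul_le_sum _ _ _ fun i hi => hmax i hi j hj) (by positivity)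
        refine this.trans (le_of_eq ?_)
        have h2 : √(s : ℝ) * √(s : ℝ) = s := Real.mul_self_sqrt hs0.le
        have h3 : √(s : ℝ) ≠ 0 := (Real.sqrt_pos.2 hs0).ne'
        rw [← mul_div_assoc, div_eq_div_iff hs0.ne' h3]
        linear_combination (∑ i ∈ V, ‖x i‖) * h2
      calc Φ (restrictTo (T \ V) x)
          ≤ Φ (restrictTo U x) + Φ (restrictTo ((T \ V) \ U) x) := by
            rw [hsplit]; exact map_add_le_add Φ _ _
        _ ≤ K * ((∑ i ∈ V, ‖x i‖) / √(s : ℝ)) + K * ((∑ i ∈ T \ V, ‖x i‖) / √(s : ℝ)) :=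
            add_le_add ((hΦ _ (isSparse_restrictTo U x hU)).trans
              (mul_le_mul_of_nonneg_left hU1 hK)) hΦU
        _ = K * ((∑ i ∈ T, ‖x i‖) / √(s : ℝ)) := by
            rw [← Finset.sum_sdiff hVT]; ring

/-- Under the restricted isometry property of order `2s`, a vector is controlled by its image and
by the `ℓ¹` norm of its restriction to the complement of any set of `s` coordinates. -/
theorem HasRIP.norm_le {ι κ : Type} [DecidableEq ι] [Fintype ι] [Fintype κ]
    {A : EuclideanSpace ℂ ι →ₗ[ℂ] EuclideanSpace ℂ κ} {s : ℕ} (hs : 1 ≤ s) {δ : ℝ} (hδ : δ < 1)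
    (hA : HasRIP A (2 * s) δ) (S : Finset ι) (hS : S.card ≤ s) (x : EuclideanSpace ℂ ι) :
    ‖x‖ ≤ (1 + 1 / √(1 - δ)) * (‖A x‖ + 3 * ((∑ i ∈ Sᶜ, ‖x i‖) / √(s : ℝ))) := by
  have hupper : ∀ y, IsSparse s y → ‖A y‖ ≤ 2 * ‖y‖ := by
    intro y hy
    have h1 := (hA y (hy.trans (by norm_cast; omega))).2
    refine le_of_pow_le_pow_left₀ two_ne_zero (by positivity) ?_
    nlinarith [sq_nonneg ‖y‖]
  -- The sum of both norms lets one tail estimate bound `‖A z‖` and `‖z‖` together; hence `K = 2 +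
  -- 1`.
  let Φ : Seminorm ℂ (EuclideanSpace ℂ ι) := (normSeminorm ℂ _).comp A + normSeminorm ℂ _
  have hΦ : ∀ y, Φ y = ‖A y‖ + ‖y‖ := fun y => rfl
  obtain ⟨U, hU, hUs, hle, -⟩ := exists_tail_seminorm_le Φ (K := 3) (by norm_num) hs
    (fun y hy => by rw [hΦ]; linarith [hupper y hy]) x Sᶜ
  set R := 3 * ((∑ i ∈ Sᶜ, ‖x i‖) / √(s : ℝ)) with hR
  have hdisj : Disjoint S U := Finset.disjoint_left.2 fun i hi hi' => by
    simpa [hi] using hU hi'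
  set y := restrictTo (S ∪ U) x
  set z := restrictTo (Sᶜ \ U) x
  have hxyz : y + z = x := by
    rw [restrictTo_add_of_disjoint]
    · have : S ∪ U ∪ Sᶜ \ U = Finset.univ := by
        ext i; simp; tauto
      rw [this, restrictTo_univ]
    · refine Finset.disjoint_left.2 fun i hi => ?_
      simp at hi ⊢; tauto
  rw [hΦ] at hle
  -- `S ∪ U` has up to `2s` elements: the full RIP order is needed here.
  have hy : √(1 - δ) * ‖y‖ ≤ ‖A y‖ := by
    have h1 := (hA y (isSparse_restrictTo _ x
      ((Finset.card_union_le _ _).trans (by omega)))).1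
    refine le_of_pow_le_pow_left₀ two_ne_zero (by positivity) ?_
    rwa [mul_pow, Real.sq_sqrt (by linarith)]
  have hd : 0 < √(1 - δ) := Real.sqrt_pos.2 (by linarith)
  have hAy : ‖A y‖ ≤ ‖A x‖ + ‖A z‖ := by
    have : A y = A x - A z := by rw [← hxyz, map_add]; abel
    rw [this]; exact norm_sub_le _ _
  have h2 : ‖y‖ ≤ 1 / √(1 - δ) * (‖A x‖ + R) := by
    rw [one_div, inv_mul_eq_div, le_div_iff₀ hd, mul_comm]
    linarith [norm_nonneg z]
  have h3 : ‖x‖ ≤ ‖y‖ + ‖z‖ := by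
    conv_lhs => rw [← hxyz]
    exact norm_add_le _ _
  linarith [norm_nonneg (A z), norm_nonneg (A x)]
-- Haar coefficients at one scale and the total variation
/-- The univariate Haar coefficients at one scale are controlled by the variation. -/
theorem sum_norm_haarUni_le {n j : ℕ} (hj : j < n) (f : ℕ → ℂ) :
    ∑ k ∈ Finset.range (2 ^ j), ‖∑ p ∈ Finset.range (2 ^ n),
        f p * (haarUni 1 (2 ^ j * ((p : ℝ) / 2 ^ n) - k) : ℂ)‖ ≤
      2 ^ (n - j) * ∑ p ∈ Finset.range (2 ^ n - 1), ‖f (p + 1) - f p‖ := by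
  -- The jump from `p` to `p + 1` is charged to the dyadic interval containing `p`, so each jump is
  -- counted exactly once.
  set V : ℕ → ℝ := fun k =>
    ∑ p ∈ Finset.range (2 ^ n - 1) with p / 2 ^ (n - j) = k, ‖f (p + 1) - f p‖ with hVdef
  have hV : ∑ k ∈ Finset.range (2 ^ j), V k = ∑ p ∈ Finset.range (2 ^ n - 1), ‖f (p + 1) - f p‖ := by
    refine Finset.sum_fiberwise_of_maps_to (g := fun p => p / 2 ^ (n - j)) (fun p hp => ?_) _
    rw [Finset.mem_range] at hp ⊢
    rw [Nat.div_lt_iff_lt_mul (by positivity), ← pow_add, Nat.add_sub_cancel' hj.le]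
    omega
  rw [← hV, Finset.mul_sum]
  refine Finset.sum_le_sum fun k hk => ?_
  rw [Finset.mem_range] at hk
  set a := k * 2 ^ (n - j)
  -- Mean zero allows subtracting the value of `f` at the left end `a` of the interval.
  have hzero : ∑ p ∈ Finset.range (2 ^ n),
      f a * (haarUni 1 (2 ^ j * ((p : ℝ) / 2 ^ n) - k) : ℂ) = 0 := by
    have := haarUni_sum_zero hj k hk 1 (fun _ => 1) fun _ _ => rfl
    rw [Fin.sum_univ_eq_sum_range
      (fun p => 1 * haarUni 1 (2 ^ j * ((p : ℝ) / 2 ^ n) - k))] at this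
    simp only [one_mul] at this
    rw [← Finset.mul_sum, ← Complex.ofReal_sum, this]
    simp
  have hsq : ∑ p ∈ Finset.range (2 ^ n),
      haarUni 1 (2 ^ j * ((p : ℝ) / 2 ^ n) - k) * haarUni 1 (2 ^ j * ((p : ℝ) / 2 ^ n) - k) =
        2 ^ (n - j) := by
    rw [← haarUni_sum_sq 1 hj k hk, Fin.sum_univ_eq_sum_range
      (fun p => haarUni 1 (2 ^ j * ((p : ℝ) / 2 ^ n) - k) *
        haarUni 1 (2 ^ j * ((p : ℝ) / 2 ^ n) - k))]
  -- The Haar values are `0` and `±1`, so absolute values equal squares and the comparison can be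
  -- made term by term.
  rw [← sub_zero (∑ p ∈ Finset.range (2 ^ n), _), ← hzero, ← Finset.sum_sub_distrib, ← hsq,
    Finset.sum_mul]
  refine norm_sum_le_of_le _ fun p hp => ?_
  rw [← sub_mul, norm_mul, Complex.norm_real, haarUni_grid 1 hj]
  by_cases hpk : p / 2 ^ (n - j) = k
  · have hosc : ‖f p - f a‖ ≤ V k := by
      have hap : a ≤ p := by
        simpa only [a, ← hpk] using Nat.div_mul_le_self p (2 ^ (n - j))
      rw [← Finset.sum_Ico_sub f hap]
      refine (norm_sum_le _ _).trans
        (Finset.sum_le_sum_of_subset_of_nonneg (fun i hi => ?_) fun _ _ _ => norm_nonneg _)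
      rw [Finset.mem_Ico] at hi
      rw [Finset.mem_range] at hp
      simp only [Finset.mem_filter, Finset.mem_range]
      refine ⟨by omega, le_antisymm ?_ ?_⟩
      · rw [← hpk]; exact Nat.div_le_div_right hi.2.le
      · exact (Nat.le_div_iff_mul_le (by positivity)).2 hi.1
    rw [if_pos hpk]
    split_ifs <;> simpa using hosc
  · rw [if_neg hpk]; simp

/-- The dyadic intervals of one scale are disjoint, so at most one `k` contributes. -/
theorem sum_abs_haarUni_le (e : Fin 2) {n j : ℕ} (hj : j < n) (q : ℕ) :
    ∑ k ∈ Finset.range (2 ^ j), |haarUni e (2 ^ j * ((q : ℝ) / 2 ^ n) - k)| ≤ 1 := by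
  have : ∀ k ∈ Finset.range (2 ^ j), |haarUni e (2 ^ j * ((q : ℝ) / 2 ^ n) - k)| =
      if q / 2 ^ (n - j) = k then 1 else 0 := by
    intro k _
    rw [haarUni_grid e hj]
    split_ifs <;> simp
  rw [Finset.sum_congr rfl this, Finset.sum_ite_eq]
  split_ifs <;> norm_num

/-- Bivariate Haar sums that oscillate in the first variable are controlled, at each scale, by the
variation in that variable. -/
theorem sum_norm_haar_prod_le (e : Fin 2) {n j : ℕ} (hj : j < n) (F : ℕ → ℕ → ℂ) :
    ∑ k ∈ Finset.range (2 ^ j), ∑ l ∈ Finset.range (2 ^ j),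
      ‖∑ q ∈ Finset.range (2 ^ n), (∑ p ∈ Finset.range (2 ^ n),
        F p q * (haarUni 1 (2 ^ j * ((p : ℝ) / 2 ^ n) - k) : ℂ)) *
          (haarUni e (2 ^ j * ((q : ℝ) / 2 ^ n) - l) : ℂ)‖ ≤
      2 ^ (n - j) * ∑ q ∈ Finset.range (2 ^ n), ∑ p ∈ Finset.range (2 ^ n - 1),
        ‖F (p + 1) q - F p q‖ := by
  set c : ℕ → ℕ → ℂ := fun k q => ∑ p ∈ Finset.range (2 ^ n),
    F p q * (haarUni 1 (2 ^ j * ((p : ℝ) / 2 ^ n) - k) : ℂ)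
  calc ∑ k ∈ Finset.range (2 ^ j), ∑ l ∈ Finset.range (2 ^ j),
      ‖∑ q ∈ Finset.range (2 ^ n), c k q * (haarUni e (2 ^ j * ((q : ℝ) / 2 ^ n) - l) : ℂ)‖
      ≤ ∑ k ∈ Finset.range (2 ^ j), ∑ l ∈ Finset.range (2 ^ j), ∑ q ∈ Finset.range (2 ^ n),
        ‖c k q‖ * |haarUni e (2 ^ j * ((q : ℝ) / 2 ^ n) - l)| := by
        refine Finset.sum_le_sum fun k _ => Finset.sum_le_sum fun l _ =>
          norm_sum_le_of_le _ fun q _ => ?_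
        rw [norm_mul, Complex.norm_real, Real.norm_eq_abs]
    _ = ∑ q ∈ Finset.range (2 ^ n), ∑ k ∈ Finset.range (2 ^ j), ‖c k q‖ *
        ∑ l ∈ Finset.range (2 ^ j), |haarUni e (2 ^ j * ((q : ℝ) / 2 ^ n) - l)| := by
        conv_rhs => rw [Finset.sum_comm]
        refine Finset.sum_congr rfl fun k _ => ?_
        rw [Finset.sum_comm]
        simp only [Finset.mul_sum]
    _ ≤ ∑ q ∈ Finset.range (2 ^ n), ∑ k ∈ Finset.range (2 ^ j), ‖c k q‖ :=
        Finset.sum_le_sum fun q _ => Finset.sum_le_sum fun k _ =>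
          mul_le_of_le_one_right (norm_nonneg _) (sum_abs_haarUni_le e hj q)
    _ ≤ _ := by
        rw [Finset.mul_sum]
        exact Finset.sum_le_sum fun q _ => sum_norm_haarUni_le hj fun p => F p q

/-- The extension by zero of an image to all pairs of natural numbers. -/
noncomputable def extendImage {N : ℕ} (X : Image N) (p q : ℕ) : ℂ :=
  if h : p < N ∧ q < N then X (⟨p, h.1⟩, ⟨q, h.2⟩) else 0

theorem extendImage_coe {N : ℕ} (X : Image N) (p q : Fin N) : extendImage X p q = X (p, q) := by
  simp [extendImage]

theorem variation_fst_le_tvNorm {N : ℕ} (X : Image N) :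
    ∑ q ∈ Finset.range N, ∑ p ∈ Finset.range (N - 1),
      ‖extendImage X (p + 1) q - extendImage X p q‖ ≤ tvNorm X := by
  rw [Finset.sum_comm' (t' := Finset.range (N - 1)) (s' := fun _ => Finset.range N) (by tauto)]
  have h1 : ∑ p : Fin N, ∑ q : Fin N, ‖gradX X p q‖ ≤ tvNorm X :=
    Finset.sum_le_sum fun p _ => Finset.sum_le_sum fun q _ =>
      le_add_of_nonneg_right (norm_nonneg _)
  refine le_trans ?_ h1
  have h2 : ∑ p : Fin N, ∑ q : Fin N, ‖gradX X p q‖ = ∑ p ∈ Finset.range N,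
      ∑ q ∈ Finset.range N, if p + 1 < N then
        ‖extendImage X (p + 1) q - extendImage X p q‖ else 0 := by
    rw [← Fin.sum_univ_eq_sum_range (fun p => ∑ q ∈ Finset.range N, if p + 1 < N then
        ‖extendImage X (p + 1) q - extendImage X p q‖ else 0)]
    refine Finset.sum_congr rfl fun p _ => ?_
    rw [← Fin.sum_univ_eq_sum_range (fun q => if (p : ℕ) + 1 < N then
        ‖extendImage X (p + 1) q - extendImage X p q‖ else 0)]
    refine Finset.sum_congr rfl fun q _ => ?_
    unfold gradX
    split_ifs with h
    · rw [extendImage_coe, ← extendImage_coe X ⟨(p : ℕ) + 1, h⟩ q]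
    · simp
  rw [h2]
  refine (Finset.sum_le_sum fun p hp => Finset.sum_le_sum fun q _ => ?_).trans
    (Finset.sum_le_sum_of_subset_of_nonneg (s := Finset.range (N - 1))
      (Finset.range_mono (Nat.sub_le _ _)) fun p _ _ => Finset.sum_nonneg fun q _ => ?_)
  · rw [Finset.mem_range] at hp
    simp only [if_pos (show p + 1 < N by omega), le_refl]
  · positivity

/-- The transpose of an image. -/
noncomputable def transposeImage {N : ℕ} (X : Image N) : Image N :=
  WithLp.toLp 2 fun p => X (p.2, p.1)

theorem tvNorm_transposeImage {N : ℕ} (X : Image N) : tvNorm (transposeImage X) = tvNorm X := by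
  unfold tvNorm
  rw [Finset.sum_comm]
  exact Finset.sum_congr rfl fun j _ => Finset.sum_congr rfl fun k _ => add_comm _ _

/-- The normalisation `2 ^ j / N` is the reciprocal of the factor `2 ^ (n - j)` in
`sum_norm_haar_prod_le`, which makes the resulting bound independent of the scale. -/
theorem haarTransform_inr {n : ℕ} (X : Image (2 ^ n)) (j : Fin n)
    (k : Fin (2 ^ (j : ℕ)) × Fin (2 ^ (j : ℕ))) (e : {e : Fin 2 × Fin 2 // e ≠ (0, 0)}) :
    haarTransform n X (Sum.inr ⟨j, k, e⟩) = ((2 ^ (n - j) : ℝ) : ℂ)⁻¹ *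
      ∑ q ∈ Finset.range (2 ^ n), (∑ p ∈ Finset.range (2 ^ n),
        extendImage X p q * (haarUni e.1.1 (2 ^ (j : ℕ) * ((p : ℝ) / 2 ^ n) - (k.1 : ℕ)) : ℂ)) *
          (haarUni e.1.2 (2 ^ (j : ℕ) * ((q : ℝ) / 2 ^ n) - (k.2 : ℕ)) : ℂ) := by
  rw [haarTransform_apply, Fintype.sum_prod_type, Finset.sum_comm, Finset.mul_sum,
    ← Fin.sum_univ_eq_sum_range (fun q => ((2 ^ (n - j) : ℝ) : ℂ)⁻¹ *
      ((∑ p ∈ Finset.range (2 ^ n),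
        extendImage X p q * (haarUni e.1.1 (2 ^ (j : ℕ) * ((p : ℝ) / 2 ^ n) - (k.1 : ℕ)) : ℂ)) *
          (haarUni e.1.2 (2 ^ (j : ℕ) * ((q : ℝ) / 2 ^ n) - (k.2 : ℕ)) : ℂ)))]
  refine Finset.sum_congr rfl fun q _ => ?_
  rw [← Fin.sum_univ_eq_sum_range (fun p =>
    extendImage X p q * (haarUni e.1.1 (2 ^ (j : ℕ) * ((p : ℝ) / 2 ^ n) - (k.1 : ℕ)) : ℂ)),
    Finset.sum_mul, Finset.mul_sum]
  refine Finset.sum_congr rfl fun p _ => ?_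
  have hM : ((2 : ℂ) ^ n)⁻¹ * 2 ^ (j : ℕ) = (2 ^ (n - j))⁻¹ := by
    have : (2 : ℂ) ^ n = 2 ^ (n - j) * 2 ^ (j : ℕ) := by
      rw [← pow_add, Nat.sub_add_cancel j.2.le]
    rw [this]; field_simp
  simp only [haarVec, haarFun, haarBiv, Complex.conj_ofReal, extendImage_coe]
  push_cast
  rw [← hM]
  ring

theorem sum_norm_haarTransform_le {n : ℕ} (X : Image (2 ^ n)) (j : Fin n)
    (e : {e : Fin 2 × Fin 2 // e ≠ (0, 0)}) :
    ∑ k : Fin (2 ^ (j : ℕ)) × Fin (2 ^ (j : ℕ)), ‖haarTransform n X (Sum.inr ⟨j, k, e⟩)‖ ≤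
      tvNorm X := by
  have hM : (0 : ℝ) < 2 ^ (n - j) := by positivity
  have key : ∀ (Y : Image (2 ^ n)) (a : Fin 2), (2 ^ (n - j) : ℝ)⁻¹ *
      ∑ k ∈ Finset.range (2 ^ (j : ℕ)), ∑ l ∈ Finset.range (2 ^ (j : ℕ)),
      ‖∑ q ∈ Finset.range (2 ^ n), (∑ p ∈ Finset.range (2 ^ n),
        extendImage Y p q * (haarUni 1 (2 ^ (j : ℕ) * ((p : ℝ) / 2 ^ n) - k) : ℂ)) *
          (haarUni a (2 ^ (j : ℕ) * ((q : ℝ) / 2 ^ n) - l) : ℂ)‖ ≤ tvNorm Y := by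
    intro Y a
    rw [inv_mul_le_iff₀ hM]
    exact (sum_norm_haar_prod_le a j.2 _).trans
      (mul_le_mul_of_nonneg_left (variation_fst_le_tvNorm Y) hM.le)
  have hnorm : ‖((2 ^ (n - j) : ℝ) : ℂ)⁻¹‖ = (2 ^ (n - j) : ℝ)⁻¹ := by
    rw [norm_inv, Complex.norm_real, Real.norm_of_nonneg hM.le]
  simp only [haarTransform_inr, norm_mul, hnorm]
  rw [← Finset.mul_sum, Fintype.sum_prod_type]
  obtain ⟨⟨a, b⟩, he⟩ := e
  have : a = 1 ∨ b = 1 := by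
    revert he; revert a b; decide
  rcases this with rfl | rfl
  · refine le_trans (le_of_eq ?_) (key X b)
    rw [← Fin.sum_univ_eq_sum_range (fun k => ∑ l ∈ Finset.range (2 ^ (j : ℕ)), _)]
    congr 1
    refine Finset.sum_congr rfl fun k _ => ?_
    exact Fin.sum_univ_eq_sum_range (fun l => ‖∑ q ∈ Finset.range (2 ^ n),
      (∑ p ∈ Finset.range (2 ^ n),
        extendImage X p q * (haarUni 1 (2 ^ (j : ℕ) * ((p : ℝ) / 2 ^ n) - (k : ℕ)) : ℂ)) *
          (haarUni b (2 ^ (j : ℕ) * ((q : ℝ) / 2 ^ n) - l) : ℂ)‖) _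
  -- Oscillation in the second variable only is reduced to the first by transposing the image.
  · rw [← tvNorm_transposeImage]
    refine le_trans (le_of_eq ?_) (key (transposeImage X) a)
    rw [Finset.sum_comm,
      ← Fin.sum_univ_eq_sum_range (fun k => ∑ l ∈ Finset.range (2 ^ (j : ℕ)), _)]
    congr 1
    refine Finset.sum_congr rfl fun k _ => ?_
    rw [← Fin.sum_univ_eq_sum_range (fun l => ‖_‖)]
    refine Finset.sum_congr rfl fun l _ => ?_
    congr 1
    simp only [Finset.sum_mul]
    rw [Finset.sum_comm]
    refine Finset.sum_congr rfl fun p _ => Finset.sum_congr rfl fun q _ => ?_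
    have : extendImage (transposeImage X) q p = extendImage X p q := by
      simp only [extendImage, transposeImage, and_comm]
    rw [this]
    ring
-- Counting coarse indices and summing over fine scales
noncomputable instance instDecidableEqHaarIndex (n : ℕ) : DecidableEq (HaarIndex n) :=
  Classical.decEq _

/-- A wavelet of scale at least `J`. -/
def IsFine {n : ℕ} (J : ℕ) : HaarIndex n → Prop
  | Sum.inl _ => False
  | Sum.inr t => J ≤ (t.1 : ℕ)

noncomputable instance instDecidablePredIsFine (n J : ℕ) : DecidablePred (IsFine (n := n) J) :=
  Classical.decPred _

/-- The indices of the constant function and of the wavelets of scale below `J`. -/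
noncomputable def coarseIndices (n J : ℕ) : Finset (HaarIndex n) :=
  (Finset.univ.filter (IsFine J))ᶜ

theorem sum_compl_coarseIndices (n J : ℕ) (f : HaarIndex n → ℝ) :
    ∑ i ∈ (coarseIndices n J)ᶜ, f i =
      ∑ j : Fin n, if J ≤ (j : ℕ) then ∑ e, ∑ k, f (Sum.inr ⟨j, k, e⟩) else 0 := by
  rw [coarseIndices, compl_compl, Finset.sum_filter, Fintype.sum_sum_type]
  have h : ∀ u ∈ (Finset.univ : Finset Unit),
      (if IsFine J (Sum.inl u : HaarIndex n) then f (Sum.inl u) else 0) = 0 :=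
    fun u _ => if_neg id
  rw [Finset.sum_eq_zero h, zero_add, Fintype.sum_sigma]
  refine Finset.sum_congr rfl fun j _ => ?_
  by_cases hj : J ≤ (j : ℕ)
  · rw [if_pos hj, Fintype.sum_prod_type, Finset.sum_comm]
    exact Finset.sum_congr rfl fun e _ => Finset.sum_congr rfl fun k _ => if_pos hj
  · rw [if_neg hj]
    exact Finset.sum_eq_zero fun t _ => if_neg hj

/-- Three types at each scale give `1 + 3 (1 + 4 + ⋯ + 4 ^ (J - 1)) = 4 ^ J`; the telescoping is
done on the complement. -/
theorem card_coarseIndices {n J : ℕ} (hJ : J ≤ n) : (coarseIndices n J).card = 2 ^ J * 2 ^ J := by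
  have h3 : Fintype.card {e : Fin 2 × Fin 2 // e ≠ (0, 0)} = 3 := by decide
  have h1 := sum_compl_coarseIndices n J fun _ => 1
  have h2 : ∀ m, J ≤ m → ∑ j ∈ Finset.range m with J ≤ j, (3 : ℝ) * (2 ^ j * 2 ^ j) =
      2 ^ m * 2 ^ m - 2 ^ J * 2 ^ J := by
    intro m hm
    induction m, hm using Nat.le_induction with
    | base =>
      rw [Finset.filter_false_of_mem fun j hj => not_le.2 (Finset.mem_range.1 hj)]
      simp
    | succ m hm ih =>
      rw [Finset.range_add_one, Finset.filter_insert, if_pos hm, Finset.sum_insert (by simp), ih]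
      ring
  have h4 : (∑ j : Fin n, if J ≤ (j : ℕ) then (3 : ℝ) * (2 ^ (j : ℕ) * 2 ^ (j : ℕ)) else 0) =
      2 ^ n * 2 ^ n - 2 ^ J * 2 ^ J := by
    rw [← h2 n hJ, Finset.sum_filter, Fin.sum_univ_eq_sum_range
      (fun j => if J ≤ j then (3 : ℝ) * (2 ^ j * 2 ^ j) else 0)]
  simp only [Finset.sum_const, Finset.card_univ, Fintype.card_prod, Fintype.card_fin, h3,
    nsmul_eq_mul, mul_one] at h1
  push_cast at h1
  rw [h4] at h1
  have h5 := Finset.card_add_card_compl (coarseIndices n J)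
  rw [card_haarIndex] at h5
  have h6 : ((coarseIndices n J).card : ℝ) + ((coarseIndices n J)ᶜ.card : ℝ) = 2 ^ n * 2 ^ n := by
    exact_mod_cast h5
  have h7 : ((coarseIndices n J).card : ℝ) = 2 ^ J * 2 ^ J := by linarith
  exact_mod_cast h7

theorem tvNorm_nonneg {N : ℕ} (X : Image N) : 0 ≤ tvNorm X := by
  unfold tvNorm; positivity

theorem sum_compl_coarseIndices_haarTransform_le {n J : ℕ} (hJ : J ≤ n) (X : Image (2 ^ n)) :
    ∑ i ∈ (coarseIndices n J)ᶜ, ‖haarTransform n X i‖ ≤ 3 * ((n : ℝ) - J) * tvNorm X := by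
  have h3 : Fintype.card {e : Fin 2 × Fin 2 // e ≠ (0, 0)} = 3 := by decide
  have hcard : (Finset.univ.filter fun j : Fin n => J ≤ (j : ℕ)).card = n - J := by
    rw [Finset.card_filter, Fin.sum_univ_eq_sum_range (fun j => if J ≤ j then 1 else 0),
      ← Finset.card_filter]
    have : (Finset.range n).filter (J ≤ ·) = Finset.Ico J n := by
      ext i; simp [and_comm]
    rw [this, Nat.card_Ico]
  rw [sum_compl_coarseIndices, ← Finset.sum_filter]
  calc _ ≤ (Finset.univ.filter fun j : Fin n => J ≤ (j : ℕ)).card • (3 * tvNorm X) := by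
        refine Finset.sum_le_card_nsmul _ _ _ fun j _ => ?_
        refine (Finset.sum_le_card_nsmul _ _ _ fun e _ =>
          sum_norm_haarTransform_le X j e).trans (le_of_eq ?_)
        rw [Finset.card_univ, h3]; simp
    _ = _ := by
        rw [hcard, nsmul_eq_mul, Nat.cast_sub hJ]; ring

/-- Outside the wavelets of coarsest scales, at most `s` in number, the Haar coefficients have
`ℓ¹` norm at most a multiple of the total variation times `log (N² / s)`. -/
theorem exists_sum_compl_haarTransform_le {n s : ℕ} (hs : 1 ≤ s) (hsn : 2 * s ≤ (2 ^ n) ^ 2) :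
    ∃ S : Finset (HaarIndex n), S.card ≤ s ∧ ∀ X : Image (2 ^ n),
      ∑ i ∈ Sᶜ, ‖haarTransform n X i‖ ≤
        9 / (2 * Real.log 2) * (tvNorm X * Real.log ((2 ^ n : ℝ) ^ 2 / s)) := by
  set J := Nat.log 4 s
  have h1 : 4 ^ J ≤ s := Nat.pow_log_le_self 4 (by omega)
  have h2 : s < 4 ^ (J + 1) := Nat.lt_pow_succ_log_self (by norm_num) s
  have h4n : (2 ^ n) ^ 2 = 4 ^ n := by rw [← pow_mul, mul_comm, pow_mul]; norm_num
  have hJ : J ≤ n := by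
    refine (Nat.pow_le_pow_iff_right (by norm_num : 1 < 4)).1 ?_
    rw [h4n] at hsn; omega
  have hs0 : (0 : ℝ) < s := by exact_mod_cast hs
  have hl2 : 0 < Real.log 2 := Real.log_pos (by norm_num)
  have hl4 : Real.log 4 = 2 * Real.log 2 := by
    rw [show (4 : ℝ) = 2 ^ 2 by norm_num, Real.log_pow]; norm_num
  set L := Real.log ((2 ^ n : ℝ) ^ 2 / s)
  have hLeq : L = n * (2 * Real.log 2) - Real.log s := by
    rw [← hl4, ← Real.log_pow, ← Real.log_div (by positivity) hs0.ne']
    have : ((2 : ℝ) ^ n) ^ 2 = 4 ^ n := by exact_mod_cast h4n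
    rw [← this]
  -- The assumption `2 s ≤ N²` keeps `L` away from zero, so that it can absorb the rounding in `J`.
  have hL1 : Real.log 2 ≤ L := by
    refine Real.log_le_log (by norm_num) ?_
    rw [le_div_iff₀ hs0]
    exact_mod_cast hsn
  have hL2 : Real.log s ≤ (J + 1) * (2 * Real.log 2) := by
    have := Real.log_le_log hs0 (y := 4 ^ (J + 1)) (by exact_mod_cast h2.le)
    rw [Real.log_pow, hl4] at this
    exact_mod_cast this
  -- `(n - J) log 4 ≤ L + log 4 ≤ 3 L`, since `log 4 = 2 log 2`.
  have hnJ : (n : ℝ) - J ≤ 3 / (2 * Real.log 2) * L := by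
    rw [div_mul_eq_mul_div, le_div_iff₀ (by positivity)]
    linarith
  refine ⟨coarseIndices n J, ?_, fun X => ?_⟩
  · rw [card_coarseIndices hJ, ← mul_pow]; exact h1
  · refine (sum_compl_coarseIndices_haarTransform_le hJ X).trans ?_
    have := mul_le_mul_of_nonneg_right hnJ (tvNorm_nonneg X)
    calc 3 * ((n : ℝ) - J) * tvNorm X = 3 * (((n : ℝ) - J) * tvNorm X) := by ring
      _ ≤ 3 * (3 / (2 * Real.log 2) * L * tvNorm X) := by linarith
      _ = _ := by ring

/-! ### The strong Sobolev inequality -/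

theorem norm_haarTransform (n : ℕ) (X : Image (2 ^ n)) : ‖haarTransform n X‖ = ‖X‖ :=
  (haarBasis n).repr.norm_map X

theorem mainTheorem3 (δ : ℝ) (hδ : δ < 1) :
    ∃ C : ℝ, 0 < C ∧
      ∀ (n m s : ℕ), 1 ≤ s → s ≤ (2 ^ n) ^ 2 →
        ∀ B : Image (2 ^ n) →ₗ[ℂ] EuclideanSpace ℂ (Fin m),
          HasRIP (B ∘ₗ (haarTransform n).symm.toLinearMap) (2 * s) δ →
            ∀ (D : Image (2 ^ n)) (ε : ℝ), ‖B D‖ ≤ ε →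
              ‖D‖ ≤ C * (tvNorm D / √(s : ℝ) * Real.log ((2 ^ n : ℝ) ^ 2 / s) + ε) := by
  have hd : 0 < √(1 - δ) := Real.sqrt_pos.2 (by linarith)
  have hl2 : 0 < Real.log 2 := Real.log_pos (by norm_num)
  set c := 1 + 1 / √(1 - δ) with hc
  have hc0 : 0 < c := by positivity
  -- The factor `3` of `HasRIP.norm_le` times `9 / (2 log 2)` from the fine scales.
  set K := 27 / (2 * Real.log 2) with hK
  have hK0 : 0 < K := by positivity
  refine ⟨c * (K + 1), by positivity, fun n m s hs hsn B hB D ε hD => ?_⟩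
  have hs0 : (0 : ℝ) < s := by exact_mod_cast hs
  set x := haarTransform n D with hx
  have hBx : (B ∘ₗ (haarTransform n).symm.toLinearMap) x = B D := by simp [hx]
  have hε : 0 ≤ ε := (norm_nonneg _).trans hD
  have hL : 0 ≤ Real.log ((2 ^ n : ℝ) ^ 2 / s) := by
    refine Real.log_nonneg ?_
    rw [one_le_div hs0]
    exact_mod_cast hsn
  set T := tvNorm D / √(s : ℝ) * Real.log ((2 ^ n : ℝ) ^ 2 / s) with hT
  have hT0 : 0 ≤ T := mul_nonneg (div_nonneg (tvNorm_nonneg D) (Real.sqrt_nonneg _)) hL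
  rw [← norm_haarTransform, ← hx]
  rcases le_total (2 * s) ((2 ^ n) ^ 2) with h | h
  · obtain ⟨S, hS, hsum⟩ := exists_sum_compl_haarTransform_le hs h
    have h1 := hB.norm_le hs hδ S hS x
    rw [hBx] at h1
    have h2 : 3 * ((∑ i ∈ Sᶜ, ‖x i‖) / √(s : ℝ)) ≤ K * T := by
      have := div_le_div_of_nonneg_right (hsum D) (Real.sqrt_nonneg (s : ℝ))
      calc _ ≤ 3 * (9 / (2 * Real.log 2) * (tvNorm D * Real.log ((2 ^ n : ℝ) ^ 2 / s)) /
            √(s : ℝ)) := by linarith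
        _ = K * T := by rw [hK, hT]; ring
    refine h1.trans ?_
    rw [mul_assoc]
    refine mul_le_mul_of_nonneg_left ?_ hc0.le
    nlinarith [mul_nonneg hK0.le hε]
  -- There are only `N² ≤ 2 s` coefficients, so the lower RIP bound applies to `x` itself and the
  -- variation term is not needed.
  · have hsp : IsSparse (2 * s) x := by
      rw [← restrictTo_univ x]
      refine isSparse_restrictTo _ _ ?_
      rw [Finset.card_univ, card_haarIndex, ← sq]
      exact h
    have h1 := (hB x hsp).1
    rw [hBx] at h1
    have h2 : √(1 - δ) * ‖x‖ ≤ ‖B D‖ := by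
      refine le_of_pow_le_pow_left₀ two_ne_zero (norm_nonneg _) ?_
      rwa [mul_pow, Real.sq_sqrt (by linarith)]
    have h3 : ‖x‖ ≤ 1 / √(1 - δ) * ε := by
      rw [one_div, inv_mul_eq_div, le_div_iff₀ hd, mul_comm]
      exact h2.trans hD
    calc ‖x‖ ≤ 1 / √(1 - δ) * ε := h3
      _ ≤ c * ε := mul_le_mul_of_nonneg_right (by linarith) hε
      _ ≤ c * ((K + 1) * (T + ε)) := by
          refine mul_le_mul_of_nonneg_left ?_ hc0.le
          nlinarith [mul_nonneg hK0.le hε, mul_nonneg hK0.le hT0]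
      _ = _ := by ring
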